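/- Let $D\subset\mathbb R^n$ be a bounded convex polyhedron, i.e. a bounded set of the form $\{x : Ax\le b\}$ given by finitely many linear inequalities, let $D_0$ be its set of vertices, and let $U\subseteq\mathbb R^n$ be any convex set (not necessarily closed, and not necessarily contained in $D$). Put $U_0=U\cap D_0$. For every edge (one-dimensional closed face) $e$ of $D$ such that $e\cap U\neq\emptyset$ and $e\cap U$ contains no vertex of $D$, choose one point $x_e\in e\cap U$; let $Q_1$ be the set of the chosen points and $$Q=\operatorname{conv}(U_0\cup Q_1).$$ A path-connected component of a set is a maximal nonempty path-connected subset of it. Then $D\setminus U$ has finitely many path-connected components. If $W_1,\dots,W_q$ is any enumeration of them without repetition, then the path-connected components of $D\setminus Q$ can be enumerated without repetition as $V_1,\dots,V_q$ (with the same $q$) so that $W_i\subseteq V_i$ for every $i$. Moreover, for this enumeration: 1. for every set of indices $I\subseteq\{1,\dots,q\}$, $$Q\cup\bigcup_{i\in I}V_i=\operatorname{conv}\Bigl(U_0\cup Q_1\cup\bigcup_{i\in I}(D_0\cap V_i)\Bigr);$$ 2. for every $i$, $W_i=(Q\cup V_i)\setminus U$, and $Q\cup V_i$ is a convex polyhedron,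 i.e. the solution set of finitely many linear inequalities $A^{(i)}x\le b^{(i)}$. Hence $W_i=\{x : A^{(i)}x\le b^{(i)},\ x\notin U\}$. -/

import Mathlib

open scoped Matrix

namespace PolyCut

/-- A convex polyhedron in `ℝⁿ`: the solution set `{x | A x ≤ b}` of a finite system of linear
inequalities.  (Only the vector space structure and the topology of `Fin n → ℝ` are used.) -/
def IsPolyhedron {n : ℕ} (P : Set (Fin n → ℝ)) : Prop :=
  ∃ (m : ℕ) (A : Matrix (Fin m) (Fin n) ℝ) (b : Fin m → ℝ), P = {x | A *ᵥ x ≤ b}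

/-- A face of `D`: a convex subset `F` of `D` such that every segment in `D` with an interior point
in `F` has both its ends in `F`. -/
def IsFace {n : ℕ} (D F : Set (Fin n → ℝ)) : Prop :=
  Convex ℝ F ∧ IsExtreme ℝ D F

/-- An edge of `D`: a one-dimensional face of `D`. -/
def IsEdge {n : ℕ} (D e : Set (Fin n → ℝ)) : Prop :=
  IsFace D e ∧ Module.finrank ℝ (vectorSpan ℝ e) = 1

/-- `D₀`, the set of vertices of `D`. -/
def vertices {n : ℕ} (D : Set (Fin n → ℝ)) : Set (Fin n → ℝ) :=
  D.extremePoints ℝ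

/-- The edges `e` of `D` that intersect `U` but for which `e ∩ U` contains no vertex of `D`. -/
def cutEdges {n : ℕ} (D U : Set (Fin n → ℝ)) : Set (Set (Fin n → ℝ)) :=
  {e | IsEdge D e ∧ (e ∩ U).Nonempty ∧ Disjoint (e ∩ U) (vertices D)}

/-- `U₀ ∪ Q₁`: the vertices of `D` in `U` and the selected points `p e` on the cut edges `e`. -/
def cutPoints {n : ℕ} (D U : Set (Fin n → ℝ)) (p : Set (Fin n → ℝ) → (Fin n → ℝ)) :
    Set (Fin n → ℝ) :=
  (U ∩ vertices D) ∪ p '' cutEdges D U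

/-- `Q = conv (U₀ ∪ Q₁)`. -/
def cutHull {n : ℕ} (D U : Set (Fin n → ℝ)) (p : Set (Fin n → ℝ) → (Fin n → ℝ)) :
    Set (Fin n → ℝ) :=
  convexHull ℝ (cutPoints D U p)

/-- The path-connected components of `P`: its maximal (nonempty) path-connected subsets. -/
def pathComponents {n : ℕ} (P : Set (Fin n → ℝ)) : Set (Set (Fin n → ℝ)) :=
  {W | Maximal (fun S => S ⊆ P ∧ IsPathConnected S) W}

/-- `W₁, …, W_q` is a list, without repetition, of all path-connected components of `P`. -/
def EnumeratesComponents {n q : ℕ} (P : Set (Fin n → ℝ)) (W : Fin q → Set (Fin n → ℝ)) : Prop :=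
  Function.Injective W ∧ Set.range W = pathComponents P

end PolyCut

namespace PolyCut

open Set Module
open scoped NNReal Topology

/-! Since `Q ⊆ U`, each component of `D \ U` lies in one of `D \ Q`; the point is that this map is
bijective. From a point of `D` outside a convex set `C`, some vertex outside `C` is visible
(`exists_vertex_segment_subset`), and a vertex lies in `U` iff it lies in `Q`, which gives
surjectivity.

For injectivity, take an open half-space missing `Q`. An edge of `D` inside it cannot meet `U`, so
walking up edges as in the simplex method joins all its vertices within `D \ U`
(`joinedIn_of_halfSpace`). Rotating one half-space into another handles two half-spaces with a
common point of `D` (`joinedIn_of_common_point`); a path in `D \ Q` is covered by such half-spaces,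
and connectedness finishes.

Separation from `Q` also shows that `Q` with some components of `D \ Q` is the hull of finitely many
points (`union_eq_convexHull`), hence a polyhedron by Minkowski–Weyl. -/

/-! ### Minkowski–Weyl: finitely generated cones and hulls -/

/-- The cone generated by a finite set is the solution set of finitely many homogeneous linear
inequalities. -/
theorem exists_finite_dual_of_finite_span {F : Type*} [AddCommGroup F] [Module ℝ F]
    [FiniteDimensional ℝ F] {S : Set F} (hS : S.Finite) :
    ∃ T : Set (Dual ℝ F), T.Finite ∧
      ∀ x, x ∈ Submodule.span ℝ≥0 S ↔ ∀ a ∈ T, a x ≤ 0 := by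
  induction S, hS using Set.Finite.induction_on with
  | empty =>
    let b := Module.finBasis ℝ F
    refine ⟨range b.coord ∪ range (fun i => -b.coord i),
      (finite_range _).union (finite_range _), fun x => ?_⟩
    simp only [Submodule.span_empty, Submodule.mem_bot]
    refine ⟨?_, fun h => ?_⟩
    · rintro rfl a -
      simp
    · refine b.ext_elem fun i => ?_
      have h1 := h _ (Or.inl ⟨i, rfl⟩)
      have h2 := h _ (Or.inr ⟨i, rfl⟩)
      simp only [Basis.coord_apply, LinearMap.neg_apply] at h1 h2
      simp only [map_zero, Finsupp.coe_zero, Pi.zero_apply]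
      linarith
  | @insert g S _ _ ih =>
    obtain ⟨T, hT, hTS⟩ := ih
    -- Fourier–Motzkin: `t` is eliminated from the system `a x ≤ t * a g`, `t ≥ 0`. Each `a g > 0`
    -- bounds `t` below and each `a g < 0` above; the new functionals compare these bounds.
    refine ⟨{a ∈ T | a g ≤ 0} ∪ image2 (fun a c => (-(c g)) • a + a g • c)
      {a ∈ T | 0 < a g} {c ∈ T | c g < 0}, (hT.subset (sep_subset _ _)).union
      (Set.Finite.image2 _ (hT.subset (sep_subset _ _)) (hT.subset (sep_subset _ _))),
      fun x => ?_⟩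
    rw [Submodule.mem_span_insert]
    constructor
    · rintro ⟨t, z, hz, rfl⟩
      rw [hTS] at hz
      have ht : (0 : ℝ) ≤ t := t.2
      have key : ∀ a : Dual ℝ F, a (t • g + z) = t * a g + a z := fun a => by
        rw [map_add, NNReal.smul_def, map_smul, smul_eq_mul]
      rintro a (⟨ha, hag⟩ | ⟨a, ⟨ha, hag⟩, c, ⟨hc, hcg⟩, rfl⟩)
      · rw [key]
        nlinarith [hz a ha, mul_nonneg ht (neg_nonneg.2 hag)]
      · simp only [LinearMap.add_apply, LinearMap.smul_apply, smul_eq_mul, key]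
        nlinarith [mul_nonneg (neg_nonneg.2 hcg.le) (neg_nonneg.2 (hz a ha)),
          mul_nonneg hag.le (neg_nonneg.2 (hz c hc))]
    · intro h
      -- The largest of the lower bounds serves as `t`.
      obtain ⟨t, ht, htmax⟩ := Set.exists_max_image
        (insert 0 ((fun a : Dual ℝ F => a x / a g) '' {a ∈ T | 0 < a g})) id
        (((hT.subset (sep_subset _ _)).image _).insert _) ⟨0, mem_insert _ _⟩
      have ht0 : 0 ≤ t := htmax 0 (mem_insert _ _)
      lift t to ℝ≥0 using ht0
      refine ⟨t, x - (t : ℝ) • g, (hTS _).2 fun a ha => ?_, by rw [NNReal.smul_def]; simp⟩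
      rw [map_sub, map_smul, smul_eq_mul, sub_nonpos]
      rcases lt_trichotomy (a g) 0 with hag | hag | hag
      · rcases ht with ht | ⟨c, ⟨hc, hcg⟩, ht⟩
        · simpa [ht] using h a (Or.inl ⟨ha, hag.le⟩)
        · have := h _ (Or.inr ⟨c, ⟨hc, hcg⟩, a, ⟨ha, hag⟩, rfl⟩)
          simp only [LinearMap.add_apply, LinearMap.smul_apply, smul_eq_mul] at this
          rw [← ht]
          dsimp only
          rw [div_mul_eq_mul_div, le_div_iff₀ hcg]
          nlinarith
      · simpa [hag] using h a (Or.inl ⟨ha, hag.le⟩)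
      · have := htmax _ (mem_insert_of_mem _ ⟨a, ⟨ha, hag⟩, rfl⟩)
        exact (div_le_iff₀ hag).1 this

/-- Homogenization: with `S` lifted to height 1, the result on cones applies to convex hulls. -/
theorem mem_convexHull_iff_mem_span {E : Type*} [AddCommGroup E] [Module ℝ E] {S : Set E} {x : E} :
    x ∈ convexHull ℝ S ↔ (x, (1 : ℝ)) ∈ Submodule.span ℝ≥0 ((fun y => (y, (1 : ℝ))) '' S) := by
  constructor
  · intro hx
    refine convexHull_min (t := {y : E |
      (y, (1 : ℝ)) ∈ Submodule.span ℝ≥0 ((fun y => (y, (1 : ℝ))) '' S)}) ?_ ?_ hx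
    · exact fun y hy => Submodule.subset_span ⟨y, hy, rfl⟩
    · intro y hy z hz a b ha hb hab
      rw [mem_ofPred_eq] at hy hz ⊢
      lift a to ℝ≥0 using ha
      lift b to ℝ≥0 using hb
      have := add_mem (Submodule.smul_mem _ a hy) (Submodule.smul_mem _ b hz)
      simpa [NNReal.smul_def, hab] using this
  · intro hx
    -- The alternative `w = 0` is needed when `S` is empty and no `y` exists.
    have key : ∀ w ∈ Submodule.span ℝ≥0 ((fun y => (y, (1 : ℝ))) '' S),
        w = 0 ∨ ∃ r : ℝ, 0 ≤ r ∧ ∃ y ∈ convexHull ℝ S, w = (r • y, r) := by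
      intro w hw
      induction hw using Submodule.span_induction with
      | mem w hw =>
        obtain ⟨y, hy, rfl⟩ := hw
        exact Or.inr ⟨1, zero_le_one, y, subset_convexHull _ _ hy, by simp⟩
      | zero => exact Or.inl rfl
      | add w z _ _ hw hz =>
        rcases hw with rfl | ⟨r, hr, y, hy, rfl⟩
        · simpa using hz
        rcases hz with rfl | ⟨s, hs, z, hz, rfl⟩
        · exact Or.inr ⟨r, hr, y, hy, by simp⟩
        obtain ⟨u, hu, huy⟩ := (convex_convexHull ℝ S).exists_mem_add_smul_eq hy hz hr hs
        exact Or.inr ⟨r + s, add_nonneg hr hs, u, hu, by simp [huy]⟩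
      | smul c w _ hw =>
        rcases hw with rfl | ⟨r, hr, y, hy, rfl⟩
        · exact Or.inl (smul_zero _)
        · exact Or.inr ⟨c * r, mul_nonneg c.2 hr, y, hy, by
            simp [NNReal.smul_def, mul_smul]⟩
    rcases key _ hx with h | ⟨r, -, y, hy, h⟩
    · exact absurd (congrArg Prod.snd h) one_ne_zero
    · simp only [Prod.mk.injEq] at h
      obtain ⟨h, rfl⟩ := h
      rwa [h, one_smul]

/-- The convex hull of a finite set is a polyhedron. -/
theorem isPolyhedron_convexHull {n : ℕ} {S : Set (Fin n → ℝ)} (hS : S.Finite) :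
    IsPolyhedron (convexHull ℝ S) := by
  obtain ⟨T, hT, hTS⟩ := exists_finite_dual_of_finite_span (hS.image (fun y => (y, (1 : ℝ))))
  have := hT.fintype
  let e := (Fintype.equivFin T).symm
  refine ⟨Fintype.card T, Matrix.of fun i j => (e i : Dual ℝ ((Fin n → ℝ) × ℝ)) (Pi.single j 1, 0),
    fun i => -(e i : Dual ℝ ((Fin n → ℝ) × ℝ)) (0, 1), ?_⟩
  ext x
  have hx : ∀ a : Dual ℝ ((Fin n → ℝ) × ℝ),
      a (x, 1) = (fun j => a (Pi.single j 1, 0)) ⬝ᵥ x + a (0, 1) := by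
    intro a
    have h1 : (x, (1 : ℝ)) = LinearMap.inl ℝ (Fin n → ℝ) ℝ x + (0, 1) := by simp
    rw [h1, map_add, ← LinearMap.comp_apply, LinearMap.pi_apply_eq_sum_univ _ x]
    congr 1
    refine Finset.sum_congr rfl fun j _ => ?_
    have : (fun k => if j = k then (1 : ℝ) else 0) = Pi.single j 1 := by
      ext k
      simp [Pi.single_apply, eq_comm]
    simp [this, mul_comm]
  rw [mem_convexHull_iff_mem_span, hTS]
  simp only [mem_ofPred_eq, Pi.le_def, Matrix.mulVec, hx]
  constructor
  · intro h i
    have := h _ (e i).2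
    simp only [Matrix.of_apply] at *
    linarith!
  · intro h a ha
    obtain ⟨i, hi⟩ := e.surjective ⟨a, ha⟩
    have := h i
    simp only [Matrix.of_apply, hi] at this
    linarith!

/-! ### Vertices of a polyhedron -/

theorem IsPolyhedron.isClosed {n : ℕ} {D : Set (Fin n → ℝ)} (hD : IsPolyhedron D) :
    IsClosed D := by
  obtain ⟨m, A, b, rfl⟩ := hD
  exact isClosed_le (by fun_prop) continuous_const

theorem IsPolyhedron.convex {n : ℕ} {D : Set (Fin n → ℝ)} (hD : IsPolyhedron D) :
    Convex ℝ D := by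
  obtain ⟨m, A, b, rfl⟩ := hD
  exact (convex_Iic b).linear_preimage A.mulVecLin

/-- A vertex is determined by its tight constraints: if `x` and `y` have the same ones, `x` can be
pushed slightly away from `y` inside `D`, so `x` is not extreme unless `x = y`. -/
theorem IsPolyhedron.finite_vertices {n : ℕ} {D : Set (Fin n → ℝ)} (hD : IsPolyhedron D) :
    (vertices D).Finite := by
  obtain ⟨m, A, b, rfl⟩ := hD
  refine Set.Finite.of_finite_image (f := fun x => {i | (A *ᵥ x) i = b i}) (toFinite _) ?_
  intro x hx y hy hxy
  have hxy : ∀ i, (A *ᵥ x) i = b i ↔ (A *ᵥ y) i = b i := fun i => Set.ext_iff.1 hxy i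
  have hxle : ∀ i, (A *ᵥ x) i ≤ b i := hx.1
  have hyle : ∀ i, (A *ᵥ y) i ≤ b i := hy.1
  have hev : ∀ᶠ ε : ℝ in 𝓝[>] 0, ∀ i,
      (A *ᵥ x) i + ε * ((A *ᵥ x) i - (A *ᵥ y) i) ≤ b i := by
    rw [Filter.eventually_all]
    intro i
    rcases (hxle i).eq_or_lt with h | h
    · have := (hxy i).1 h
      simp [h, this]
    · have : Filter.Tendsto (fun ε : ℝ => (A *ᵥ x) i + ε * ((A *ᵥ x) i - (A *ᵥ y) i)) (𝓝[>] 0)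
          (𝓝 ((A *ᵥ x) i + 0 * ((A *ᵥ x) i - (A *ᵥ y) i))) :=
        Filter.Tendsto.mono_left (Continuous.tendsto (by fun_prop) 0) nhdsWithin_le_nhds
      rw [zero_mul, add_zero] at this
      exact (this.eventually (gt_mem_nhds h)).mono fun _ h => le_of_lt h
  obtain ⟨ε, hε, hε0⟩ := (hev.and self_mem_nhdsWithin).exists
  have hε0 : 0 < ε := hε0
  have hmem : x + ε • (x - y) ∈ {x | A *ᵥ x ≤ b} := by
    intro i
    simpa [Matrix.mulVec_add, Matrix.mulVec_smul, Matrix.mulVec_sub] using hε i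
  have := hx.2 hy.1 hmem ⟨ε / (1 + ε), 1 / (1 + ε), by positivity, by positivity,
    by field_simp; ring, by
      ext i
      simp only [Pi.add_apply, Pi.smul_apply, Pi.sub_apply, smul_eq_mul]
      field_simp
      ring⟩
  exact this.symm

/-- Krein–Milman; finiteness of the vertex set makes the closure superfluous. -/
theorem IsPolyhedron.convexHull_vertices {n : ℕ} {D : Set (Fin n → ℝ)} (hD : IsPolyhedron D)
    (hDb : Bornology.IsBounded D) : convexHull ℝ (vertices D) = D := by
  conv_rhs => rw [← closure_convexHull_extremePoints
    (Metric.isCompact_of_isClosed_isBounded hD.isClosed hDb) hD.convex]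
  exact (hD.finite_vertices.isClosed_convexHull ℝ).closure_eq.symm

/-! ### Edges leaving a vertex -/

variable {n : ℕ} {D U : Set (Fin n → ℝ)}

/-- A vertex is the unique minimizer among the vertices of some linear functional. -/
theorem exists_dual_lt_of_mem_vertices (hfin : (vertices D).Finite)
    (hD : convexHull ℝ (vertices D) = D) {v : Fin n → ℝ} (hv : v ∈ vertices D) :
    ∃ g : StrongDual ℝ (Fin n → ℝ), ∀ u ∈ vertices D, u ≠ v → g v < g u := by
  have hDc : Convex ℝ D := hD ▸ convex_convexHull ℝ _
  have hv' : v ∉ convexHull ℝ (vertices D \ {v}) := fun h =>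
    (hDc.mem_extremePoints_iff_mem_sdiff_convexHull_sdiff.1 hv).2
      (convexHull_mono (sdiff_subset_sdiff_left extremePoints_subset) h)
  obtain ⟨g, c, hgv, hg⟩ := geometric_hahn_banach_point_closed (convex_convexHull ℝ _)
    ((hfin.subset sdiff_subset).isClosed_convexHull ℝ) hv'
  exact ⟨g, fun u hu huv => hgv.trans (hg u (subset_convexHull _ _ ⟨hu, huv⟩))⟩

theorem finrank_vectorSpan_segment {v u : Fin n → ℝ} (h : v ≠ u) :
    finrank ℝ (vectorSpan ℝ (segment ℝ v u)) = 1 := by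
  rw [← convexHull_pair, ← direction_affineSpan, affineSpan_convexHull, direction_affineSpan,
    vectorSpan_pair, finrank_span_singleton]
  exact vsub_ne_zero.2 h

/-- From a vertex which does not maximize the linear functional `f`, some edge leads to another
vertex at which `f` is larger. -/
theorem exists_edge_of_lt (hfin : (vertices D).Finite) (hD : convexHull ℝ (vertices D) = D)
    {v w : Fin n → ℝ} (hv : v ∈ vertices D) (hw : w ∈ vertices D)
    (f : StrongDual ℝ (Fin n → ℝ)) (hvw : f v < f w) :
    ∃ u ∈ vertices D, f v < f u ∧ IsEdge D (segment ℝ v u) := by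
  have hDc : Convex ℝ D := hD ▸ convex_convexHull ℝ _
  have hvD : v ∈ D := extremePoints_subset hv
  obtain ⟨h, hh⟩ := exists_dual_lt_of_mem_vertices hfin hD hv
  have hpos : ∀ u ∈ vertices D, u ≠ v → 0 < h (u - v) := fun u hu huv => by
    rw [map_sub]
    exact sub_pos.2 (hh u hu huv)
  have hwv : w ≠ v := by
    rintro rfl
    exact lt_irrefl _ hvw
  -- `B` is the vertex figure at `v`: rays from `v` to the other vertices, cut at height `h = 1`
  -- above `v`. Its extreme points give edges.
  set T := (fun u => (h (u - v))⁻¹ • (u - v)) '' (vertices D \ {v}) with hT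
  have hTfin : T.Finite := (hfin.subset sdiff_subset).image _
  set B := convexHull ℝ T
  have hBc : Convex ℝ B := convex_convexHull ℝ T
  have hB1 : ∀ b ∈ B, h b = 1 := by
    refine fun b hb => convexHull_min (t := {b | h b = 1}) ?_
      (convex_hyperplane h.toLinearMap.isLinear 1) hb
    rintro _ ⟨u, ⟨hu, huv⟩, rfl⟩
    have := (hpos u hu huv).ne'
    rw [mem_ofPred_eq, map_smul, smul_eq_mul, inv_mul_cancel₀ this]
  have hTu : ∀ u ∈ vertices D, u ≠ v →
      (h (u - v))⁻¹ • (u - v) ∈ B ∧ u = v + h (u - v) • ((h (u - v))⁻¹ • (u - v)) :=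
    fun u hu huv => ⟨subset_convexHull _ _ ⟨u, ⟨hu, huv⟩, rfl⟩, by
      rw [smul_inv_smul₀ (hpos u hu huv).ne', add_sub_cancel]⟩
  have hwB := (hTu w hw hwv).1
  have hcone : ∀ y ∈ D, ∃ s : ℝ, 0 ≤ s ∧ ∃ b ∈ B, y = v + s • b := by
    intro y hy
    rw [← hD] at hy
    refine convexHull_min (t := {y | ∃ s : ℝ, 0 ≤ s ∧ ∃ b ∈ B, y = v + s • b}) ?_ ?_ hy
    · intro u hu
      by_cases huv : u = v
      · exact ⟨0, le_rfl, _, hwB, by simp [huv]⟩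
      · exact ⟨_, (hpos u hu huv).le, _, hTu u hu huv⟩
    · rintro _ ⟨s, hs, b, hb, rfl⟩ _ ⟨r, hr, d, hd, rfl⟩ x y hx hy hxy
      obtain ⟨k, hk, hke⟩ := hBc.exists_mem_add_smul_eq hb hd (mul_nonneg hx hs) (mul_nonneg hy hr)
      refine ⟨x * s + y * r, by positivity, k, hk, ?_⟩
      rw [hke, smul_add, smul_add, mul_smul, mul_smul, add_add_add_comm, ← add_smul, hxy, one_smul]
  obtain ⟨t, ht, hft⟩ : ∃ t ∈ B.extremePoints ℝ, 0 < f t := by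
    by_contra! hneg
    have hcl : B ⊆ {b | f b ≤ 0} := by
      have hBcl := closure_convexHull_extremePoints (hTfin.isCompact_convexHull ℝ) hBc
      refine hBcl.symm.subset.trans ?_
      exact closure_minimal (convexHull_min hneg (convex_halfSpace_le f.toLinearMap.isLinear 0))
        (isClosed_le f.continuous continuous_const)
    have := hcl hwB
    rw [mem_ofPred_eq, map_smul, smul_eq_mul, map_sub f] at this
    exact absurd this (not_le.2 (mul_pos (inv_pos.2 (hpos w hw hwv)) (sub_pos.2 hvw)))
  obtain ⟨u, ⟨hu, huv⟩, hut⟩ := extremePoints_convexHull_subset ht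
  have huv : u ≠ v := huv
  have hsu := hpos u hu huv
  set σ := h (u - v)
  have hue : u = v + σ • t := by rw [← hut, smul_inv_smul₀ hsu.ne', add_sub_cancel]
  -- Beyond `u` the ray leaves `D`, or else the vertex `u` would lie strictly inside a segment of
  -- `D`.
  have hray : ∀ s : ℝ, 0 ≤ s → v + s • t ∈ D → v + s • t ∈ segment ℝ v u := by
    intro s hs hsD
    have hsσ : s ≤ σ := by
      by_contra! hlt
      refine huv (hu.2 hvD hsD ⟨(s - σ) / s, σ / s, ?_, ?_, ?_, ?_⟩).symm
      · exact div_pos (sub_pos.2 hlt) (hsu.trans hlt)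
      · exact div_pos hsu (hsu.trans hlt)
      · rw [← add_div, sub_add_cancel, div_self (hsu.trans hlt).ne']
      · have : s ≠ 0 := (hsu.trans hlt).ne'
        rw [hue]
        ext i
        simp only [Pi.add_apply, Pi.smul_apply, smul_eq_mul]
        field_simp
        ring
    refine ⟨1 - s / σ, s / σ, sub_nonneg.2 ((div_le_one hsu).2 hsσ), by positivity, by ring, ?_⟩
    rw [hue]
    ext i
    simp only [Pi.add_apply, Pi.smul_apply, smul_eq_mul]
    field_simp
    ring
  refine ⟨u, hu, ?_, ⟨convex_segment _ _, hDc.segment_subset hvD hu.1, ?_⟩,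
    finrank_vectorSpan_segment huv.symm⟩
  · rw [hue, map_add, map_smul, smul_eq_mul]
    linarith [mul_pos hsu hft]
  · intro a ha b hb z hz hzab
    obtain ⟨s, hs, β, hβ, rfl⟩ := hcone a ha
    obtain ⟨r, hr, γ, hγ, rfl⟩ := hcone b hb
    obtain ⟨x, y, hx, hy, hxy, rfl⟩ := hzab
    obtain ⟨x', y', hx', hy', hxy', hz⟩ := hz
    have hrel : (x * s) • β + (y * r) • γ = (y' * σ) • t := by
      have e1 : x • (v + s • β) + y • (v + r • γ) = v + ((x * s) • β + (y * r) • γ) := by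
        rw [smul_add, smul_add, mul_smul, mul_smul, add_add_add_comm, ← add_smul, hxy, one_smul]
      have e2 : x' • v + y' • u = v + (y' * σ) • t := by
        rw [hue, smul_add, ← add_assoc, ← add_smul, hxy', one_smul, mul_smul]
      rw [e1, e2] at hz
      exact (add_left_cancel hz).symm
    have hht : h t = 1 := hB1 t ht.1
    -- Applying `h` shows that `t` is a convex combination of `β` and `γ`; extremality of `t` then
    -- puts `a` on the ray.
    have hq : x * s + y * r = y' * σ := by
      have := congrArg h hrel
      simpa [hB1 β hβ, hB1 γ hγ, hht] using this
    rcases hs.eq_or_lt with rfl | hs0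
    · simpa using left_mem_segment ℝ v u
    suffices β = t by
      subst this
      exact hray s hs ha
    have hxs : 0 < x * s := mul_pos hx hs0
    rcases hr.eq_or_lt with rfl | hr0
    · rw [mul_zero, add_zero] at hq
      rw [mul_zero, zero_smul, add_zero, ← hq] at hrel
      exact smul_right_injective _ hxs.ne' hrel
    · have hyr : 0 < y * r := mul_pos hy hr0
      have hq0 : 0 < y' * σ := hq ▸ add_pos hxs hyr
      refine ht.2 hβ hγ ⟨x * s / (y' * σ), y * r / (y' * σ), div_pos hxs hq0, div_pos hyr hq0,
        by rw [← add_div, hq, div_self hq0.ne'], ?_⟩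
      rw [div_eq_inv_mul, div_eq_inv_mul, mul_smul, mul_smul _ (y * r), ← smul_add, hrel,
        inv_smul_smul₀ hq0.ne']

/-! ### Visible vertices and paths avoiding `U` -/

/-- A point of `D` outside a convex set `C` sees a vertex of `D` outside `C`. -/
theorem exists_vertex_segment_subset (hD : convexHull ℝ (vertices D) = D) {C : Set (Fin n → ℝ)}
    (hC : Convex ℝ C) {x : Fin n → ℝ} (hx : x ∈ D \ C) :
    ∃ v ∈ vertices D \ C, segment ℝ x v ⊆ D \ C := by
  have hDc : Convex ℝ D := hD ▸ convex_convexHull ℝ _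
  -- `C` need not be closed, so complementary convex sets replace half-spaces. If no vertex is
  -- visible, all vertices, hence `x`, lie in `Hᶜ`.
  obtain ⟨H, hH, hHc, hxH, hCH⟩ := exists_convex_convex_compl_subset (convex_singleton (𝕜 := ℝ) x)
    hC (disjoint_singleton_left.2 hx.2)
  rw [singleton_subset_iff] at hxH
  by_contra! hcon
  refine convexHull_min (fun v hv hvH => ?_) hHc (hD.symm ▸ hx.1) hxH
  exact hcon v ⟨hv, fun h => hCH h hvH⟩ fun z hz =>
    ⟨hDc.segment_subset hx.1 hv.1 hz, fun h => hCH h (hH.segment_subset hxH hvH hz)⟩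

theorem exists_vertex_lt (hD : convexHull ℝ (vertices D) = D) {x : Fin n → ℝ} (hx : x ∈ D)
    {l : StrongDual ℝ (Fin n → ℝ)} {c : ℝ} (hl : c < l x) : ∃ v ∈ vertices D, c < l v := by
  by_contra! hcon
  have hx : x ∈ {y | l y ≤ c} :=
    convexHull_min hcon (convex_halfSpace_le l.toLinearMap.isLinear c) (hD.symm ▸ hx)
  exact absurd hl (not_lt.2 hx)

theorem joinedIn_of_segment_subset {P : Set (Fin n → ℝ)} {x y : Fin n → ℝ}
    (h : segment ℝ x y ⊆ P) : JoinedIn P x y :=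
  (((convex_segment x y).isPathConnected ⟨x, left_mem_segment ℝ x y⟩).joinedIn _
    (left_mem_segment ℝ x y) _ (right_mem_segment ℝ x y)).mono h

theorem segment_subset_lt {l : StrongDual ℝ (Fin n → ℝ)} {c : ℝ} {x y : Fin n → ℝ}
    (hx : c < l x) (hy : c < l y) {z : Fin n → ℝ} (hz : z ∈ segment ℝ x y) : c < l z :=
  (convex_halfSpace_gt l.toLinearMap.isLinear c).segment_subset (x := x) (y := y) hx hy hz

variable {p : Set (Fin n → ℝ) → (Fin n → ℝ)}

/-- Adding a small multiple of `g` to `l` breaks ties of `l` and keeps its strict inequalities. -/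
theorem exists_perturbation {V : Set (Fin n → ℝ)} (hV : V.Finite)
    (l g : StrongDual ℝ (Fin n → ℝ)) :
    ∃ ε : ℝ, 0 < ε ∧ ∀ a ∈ V, ∀ b ∈ V, l a < l b → (l + ε • g) a < (l + ε • g) b := by
  have hev : ∀ᶠ ε : ℝ in 𝓝[>] 0, ∀ a ∈ V, ∀ b ∈ V, l a < l b →
      (l + ε • g) a < (l + ε • g) b := by
    rw [Filter.eventually_all_finite hV]
    intro a _
    rw [Filter.eventually_all_finite hV]
    intro b _
    rw [Filter.eventually_imp_distrib_left]
    intro hab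
    have hcont : ∀ x, Filter.Tendsto (fun ε : ℝ => (l + ε • g) x) (𝓝[>] 0) (𝓝 (l x)) := by
      intro x
      have : Filter.Tendsto (fun ε : ℝ => l x + ε * g x) (𝓝[>] 0) (𝓝 (l x + 0 * g x)) :=
        Filter.Tendsto.mono_left (Continuous.tendsto (by fun_prop) 0) nhdsWithin_le_nhds
      simpa using this
    exact (hcont a).eventually_lt (hcont b) hab
  obtain ⟨ε, hε, hε0⟩ := (hev.and self_mem_nhdsWithin).exists
  exact ⟨ε, hε0, hε⟩

/-- An edge of `D` in an open half-space missing `Q` does not meet `U`. -/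
theorem edge_subset_diff (hp : ∀ e ∈ cutEdges D U, p e ∈ e ∩ U)
    {l : StrongDual ℝ (Fin n → ℝ)} {c : ℝ} (hQ : ∀ x ∈ cutHull D U p, l x ≤ c)
    {e : Set (Fin n → ℝ)} (he : IsEdge D e) (hel : ∀ z ∈ e, c < l z) : e ⊆ D \ U := by
  refine fun z hz => ⟨he.1.2.subset hz, fun hzU => ?_⟩
  have hdisj : Disjoint (e ∩ U) (vertices D) := by
    rw [Set.disjoint_left]
    rintro x ⟨hxe, hxU⟩ hxD
    exact absurd (hQ x (subset_convexHull _ _ (Or.inl ⟨hxU, hxD⟩))) (not_le.2 (hel x hxe))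
  have hcut : e ∈ cutEdges D U := ⟨he, ⟨z, hz, hzU⟩, hdisj⟩
  exact absurd (hQ (p e) (subset_convexHull _ _ (Or.inr ⟨e, hcut, rfl⟩)))
    (not_le.2 (hel _ (hp e hcut).1))

/-- Two vertices of `D` in an open half-space missing `Q` are joined outside `U`. -/
theorem joinedIn_of_halfSpace (hfin : (vertices D).Finite) (hD : convexHull ℝ (vertices D) = D)
    (hp : ∀ e ∈ cutEdges D U, p e ∈ e ∩ U)
    {l : StrongDual ℝ (Fin n → ℝ)} {c : ℝ} (hQ : ∀ x ∈ cutHull D U p, l x ≤ c)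
    {v w : Fin n → ℝ} (hv : v ∈ vertices D) (hw : w ∈ vertices D) (hlv : c < l v)
    (hlw : c < l w) : JoinedIn (D \ U) v w := by
  obtain ⟨u, hu, humax⟩ := exists_max_image _ l hfin ⟨v, hv⟩
  obtain ⟨g, hg⟩ := exists_dual_lt_of_mem_vertices hfin hD hu
  obtain ⟨ε, hε, hεl⟩ := exists_perturbation hfin l (-g)
  -- The perturbation makes `u` the only maximizer, so the upward walk cannot stall at a tie of `l`.
  set f := l + ε • -g with hf
  have hfu : ∀ a ∈ vertices D, a ≠ u → f a < f u := by
    intro a ha hau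
    have h1 := humax a ha
    have h2 := mul_lt_mul_of_pos_left (hg a ha hau) hε
    simp only [hf, add_apply, smul_apply,
      neg_apply, smul_eq_mul]
    linarith
  have key : ∀ a ∈ vertices D, c < l a → JoinedIn (D \ U) a u := by
    by_contra! hcon
    obtain ⟨a, ⟨ha, hla, hau⟩, hmax⟩ := exists_max_image
      {a ∈ vertices D | c < l a ∧ ¬ JoinedIn (D \ U) a u} f (hfin.subset (sep_subset _ _)) hcon
    have hne : a ≠ u := by
      rintro rfl
      exact hau (joinedIn_of_segment_subset
        (by simpa using ⟨ha.1, fun h => not_lt.2 (hQ a (subset_convexHull _ _ (Or.inl ⟨h, ha⟩))) hla⟩))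
    obtain ⟨b, hb, hfab, hedge⟩ := exists_edge_of_lt hfin hD ha hu f (hfu a ha hne)
    -- `f` preserves strict inequalities of `l`, so increasing `f` never decreases `l` and the edge
    -- stays in the half-space.
    have hlab : l a ≤ l b := not_lt.1 fun h => (hεl b hb a ha h).not_gt hfab
    have hlb := hla.trans_le hlab
    have hab : JoinedIn (D \ U) a b := joinedIn_of_segment_subset
      (edge_subset_diff hp hQ hedge fun z hz => segment_subset_lt hla hlb hz)
    exact (hmax b ⟨hb, hlb, fun h => hau (hab.trans h)⟩).not_gt hfab
  exact (key v hv hlv).trans (key w hw hlw).symm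

/-- In a preconnected set covered by open sets, indices of the cover are related by every transitive
relation that relates indices of overlapping members. -/
theorem rel_of_isPreconnected {X α : Type*} [TopologicalSpace X] {K : Set X}
    (hK : IsPreconnected K) {S : α → Set X} (hS : ∀ a, IsOpen (S a)) (hKS : ∀ x ∈ K, ∃ a, x ∈ S a)
    {r : α → α → Prop} (hr : ∀ a b c, r a b → r b c → r a c)
    (hrS : ∀ x ∈ K, ∀ a b, x ∈ S a → x ∈ S b → r a b) {x y : X} (hx : x ∈ K) (hy : y ∈ K)
    {a b : α} (ha : x ∈ S a) (hb : y ∈ S b) : r a b := by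
  by_contra hab
  obtain ⟨z, hz, h1, h2⟩ := hK (⋃ (c) (_ : r a c), S c) (⋃ (c) (_ : ¬ r a c), S c)
    (isOpen_biUnion fun c _ => hS c) (isOpen_biUnion fun c _ => hS c)
    (fun z hz => by
      obtain ⟨c, hc⟩ := hKS z hz
      by_cases h : r a c
      · exact Or.inl (mem_biUnion (show c ∈ {c | r a c} from h) hc)
      · exact Or.inr (mem_biUnion (show c ∈ {c | ¬ r a c} from h) hc))
    ⟨x, hx, mem_biUnion (show a ∈ {c | r a c} from hrS x hx a a ha ha) ha⟩
    ⟨y, hy, mem_biUnion (show b ∈ {c | ¬ r a c} from hab) hb⟩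
  simp only [mem_iUnion, exists_prop] at h1 h2
  obtain ⟨c, hc, hzc⟩ := h1
  obtain ⟨d, hd, hzd⟩ := h2
  exact hd (hr _ _ _ hc (hrS z hz c d hzc hzd))

/-- Vertices separated together with a common point of `D` from `Q` are joined outside `U`. -/
theorem joinedIn_of_common_point (hfin : (vertices D).Finite)
    (hD : convexHull ℝ (vertices D) = D) (hp : ∀ e ∈ cutEdges D U, p e ∈ e ∩ U)
    {l k : StrongDual ℝ (Fin n → ℝ)} {c d : ℝ} (hl : ∀ x ∈ cutHull D U p, l x < c)
    (hk : ∀ x ∈ cutHull D U p, k x < d) {x : Fin n → ℝ} (hx : x ∈ D) (hlx : c < l x)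
    (hkx : d < k x) {v w : Fin n → ℝ} (hv : v ∈ vertices D) (hw : w ∈ vertices D) (hlv : c < l v)
    (hkw : d < k w) : JoinedIn (D \ U) v w := by
  have hcomb : ∀ t ∈ Icc (0 : ℝ) 1, ∀ a b a' b' : ℝ, a < b → a' < b' →
      (1 - t) * a + t * a' < (1 - t) * b + t * b' := by
    rintro t ⟨h0, h1⟩ a b a' b' hab hab'
    rcases h0.eq_or_lt with rfl | h0
    · simpa using hab
    · exact add_lt_add_of_le_of_lt (mul_le_mul_of_nonneg_left hab.le (sub_nonneg.2 h1))
        (mul_lt_mul_of_pos_left hab' h0)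
  have happ : ∀ (t : ℝ) (y : Fin n → ℝ), ((1 - t) • l + t • k) y = (1 - t) * l y + t * k y :=
    fun t y => rfl
  -- Every interpolated half-space misses `Q` and contains `x`, hence some vertex; vertices are
  -- related when they share a half-space.
  refine rel_of_isPreconnected (K := Icc (0 : ℝ) 1) isPreconnected_Icc
    (S := fun u : vertices D => {t : ℝ | (1 - t) * c + t * d < (1 - t) * l u + t * k u})
    (r := fun u u' => JoinedIn (D \ U) (u : Fin n → ℝ) u') (a := ⟨v, hv⟩) (b := ⟨w, hw⟩)
    (fun u => isOpen_lt (by fun_prop) (by fun_prop)) (fun t ht => ?_)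
    (fun _ _ _ h h' => h.trans h') (fun t ht a b ha hb => ?_)
    (left_mem_Icc.2 zero_le_one) (right_mem_Icc.2 zero_le_one) (by simpa) (by simpa)
  · obtain ⟨u, hu, hlu⟩ := exists_vertex_lt hD hx (l := (1 - t) • l + t • k)
      (c := (1 - t) * c + t * d) (hcomb t ht _ _ _ _ hlx hkx)
    exact ⟨⟨u, hu⟩, hlu⟩
  · exact joinedIn_of_halfSpace hfin hD hp (l := (1 - t) • l + t • k)
      (fun y hy => (hcomb t ht _ _ _ _ (hl y hy) (hk y hy)).le) a.2 b.2 ha hb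

/-- Points of `D \ U` joined outside `Q` are joined outside `U`. -/
theorem joinedIn_diff_of_joinedIn_diff_cutHull (hfin : (vertices D).Finite)
    (hD : convexHull ℝ (vertices D) = D) (hU : Convex ℝ U)
    (hp : ∀ e ∈ cutEdges D U, p e ∈ e ∩ U) (hQ : IsClosed (cutHull D U p))
    (hQU : cutHull D U p ⊆ U) {x y : Fin n → ℝ} (hx : x ∈ D \ U) (hy : y ∈ D \ U)
    (h : JoinedIn (D \ cutHull D U p) x y) : JoinedIn (D \ U) x y := by
  obtain ⟨v, hv, hxv⟩ := exists_vertex_segment_subset hD hU hx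
  obtain ⟨w, hw, hyw⟩ := exists_vertex_segment_subset hD hU hy
  have hxv := joinedIn_of_segment_subset hxv
  have hyw := joinedIn_of_segment_subset hyw
  have hsub : D \ U ⊆ D \ cutHull D U p := sdiff_subset_sdiff_right hQU
  have hvw : JoinedIn (D \ cutHull D U p) v w :=
    (hxv.mono hsub).symm.trans (h.trans (hyw.mono hsub))
  have hQc : Convex ℝ (cutHull D U p) := convex_convexHull ℝ _
  have hsep : ∀ z ∉ cutHull D U p, ∃ (l : StrongDual ℝ (Fin n → ℝ)) (c : ℝ),
      (∀ q ∈ cutHull D U p, l q < c) ∧ c < l z := fun z hz =>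
    geometric_hahn_banach_closed_point hQc hQ hz
  refine hxv.trans (JoinedIn.trans ?_ hyw.symm)
  have hmem : ∀ u (_ : u ∈ vertices D \ U), u ∈ ⋃ (l : StrongDual ℝ (Fin n → ℝ)) (c : ℝ)
      (_ : (∀ q ∈ cutHull D U p, l q < c) ∧ c < l u), {z | c < l z} := by
    intro u hu
    obtain ⟨l, c, h1, h2⟩ := hsep u (fun h => hu.2 (hQU h))
    simp only [mem_iUnion]
    exact ⟨l, c, ⟨h1, h2⟩, h2⟩
  -- The open set indexed by `u` is the union of the half-spaces that contain `u` and are separated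
  -- from `Q`.
  refine rel_of_isPreconnected (K := range hvw.somePath)
    (isPreconnected_range hvw.somePath.continuous)
    (S := fun u : vertices D => ⋃ (l : StrongDual ℝ (Fin n → ℝ)) (c : ℝ)
      (_ : (∀ q ∈ cutHull D U p, l q < c) ∧ c < l u), {z | c < l z})
    (r := fun u u' => JoinedIn (D \ U) (u : Fin n → ℝ) u') (a := ⟨v, hv.1⟩) (b := ⟨w, hw.1⟩)
    (fun u => isOpen_iUnion fun l => isOpen_iUnion fun c => isOpen_iUnion fun _ =>
      isOpen_lt continuous_const l.continuous)
    ?_ (fun _ _ _ h h' => h.trans h') ?_ (x := v) (y := w) ⟨0, hvw.somePath.source⟩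
    ⟨1, hvw.somePath.target⟩ (hmem v hv) (hmem w hw)
  · rintro _ ⟨t, rfl⟩
    have hz := hvw.somePath_mem t
    obtain ⟨l, c, hlQ, hlz⟩ := hsep _ hz.2
    obtain ⟨u, hu, hlu⟩ := exists_vertex_lt hD hz.1 hlz
    refine ⟨⟨u, hu⟩, ?_⟩
    simp only [mem_iUnion]
    exact ⟨l, c, ⟨hlQ, hlu⟩, hlz⟩
  · rintro _ ⟨t, rfl⟩ a b ha hb
    simp only [mem_iUnion] at ha hb
    obtain ⟨l, c, ⟨hl, hla⟩, hlz⟩ := ha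
    obtain ⟨k, d, ⟨hk, hkb⟩, hkz⟩ := hb
    exact joinedIn_of_common_point hfin hD hp hl hk (hvw.somePath_mem t).1 hlz hkz a.2 b.2 hla hkb

/-! ### Faces and finiteness of the cut points -/

/-- A face of a polytope is the convex hull of its vertices. -/
theorem IsFace.convexHull_inter_vertices (hD : convexHull ℝ (vertices D) = D)
    {e : Set (Fin n → ℝ)} (he : IsFace D e) : convexHull ℝ (e ∩ vertices D) = e := by
  have hDc : Convex ℝ D := hD ▸ convex_convexHull ℝ _
  refine (convexHull_min inter_subset_left he.1).antisymm fun x hx => ?_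
  -- The complement of a face in `D` is convex.
  have hsub : convexHull ℝ (vertices D \ e) ⊆ D \ e :=
    convexHull_min (sdiff_subset_sdiff_left extremePoints_subset) (he.2.convex_sdiff hDc)
  have hxD : x ∈ convexHull ℝ (vertices D) := hD.symm ▸ he.2.subset hx
  rw [← inter_union_sdiff (vertices D) e, inter_comm] at hxD
  rcases (e ∩ vertices D).eq_empty_or_nonempty with h | h1
  · rw [h, empty_union] at hxD
    exact absurd hx (hsub hxD).2
  rcases (vertices D \ e).eq_empty_or_nonempty with h | h2
  · rwa [h, union_empty] at hxD
  rw [convexHull_union h1 h2, mem_convexJoin] at hxD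
  obtain ⟨a, ha, b, hb, hxab⟩ := hxD
  have hae : a ∈ e := convexHull_min inter_subset_left he.1 ha
  rw [← insert_endpoints_openSegment] at hxab
  rcases hxab with rfl | rfl | hxab
  · exact ha
  · exact absurd hx (hsub hb).2
  · exact absurd (he.2.right_mem_of_mem_openSegment (he.2.subset hae) (hsub hb).1 hx hxab)
      (hsub hb).2

/-- Edges are determined by their vertices. -/
theorem finite_cutEdges (hfin : (vertices D).Finite) (hD : convexHull ℝ (vertices D) = D) :
    (cutEdges D U).Finite := by
  refine Set.Finite.of_finite_image (f := fun e => e ∩ vertices D)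
    (hfin.finite_subsets.subset ?_) fun e he e' he' h => ?_
  · rintro _ ⟨e, -, rfl⟩
    exact inter_subset_right
  · rw [← he.1.1.convexHull_inter_vertices hD, ← he'.1.1.convexHull_inter_vertices hD]
    exact congrArg _ h

theorem finite_cutPoints (hfin : (vertices D).Finite) (hD : convexHull ℝ (vertices D) = D) :
    (cutPoints D U p).Finite :=
  (hfin.subset inter_subset_right).union ((finite_cutEdges hfin hD).image p)

theorem cutHull_subset (hU : Convex ℝ U) (hp : ∀ e ∈ cutEdges D U, p e ∈ e ∩ U) :
    cutHull D U p ⊆ U := by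
  refine convexHull_min (union_subset inter_subset_left ?_) hU
  rintro _ ⟨e, he, rfl⟩
  exact (hp e he).2

theorem cutHull_subset_left (hD : Convex ℝ D) (hp : ∀ e ∈ cutEdges D U, p e ∈ e ∩ U) :
    cutHull D U p ⊆ D := by
  refine convexHull_min (union_subset (inter_subset_right.trans extremePoints_subset) ?_) hD
  rintro _ ⟨e, he, rfl⟩
  exact he.1.1.2.subset (hp e he).1

/-! ### Path components and their unions with `Q` -/

theorem pathComponents_eq (P : Set (Fin n → ℝ)) :
    pathComponents P = pathComponentIn P '' P := by
  ext W
  constructor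
  · rintro ⟨⟨hWP, hW⟩, hmax⟩
    obtain ⟨x, hx⟩ := hW.nonempty
    have h1 : W ⊆ pathComponentIn P x := hW.subset_pathComponentIn hx hWP
    exact ⟨x, hWP hx, (hmax ⟨pathComponentIn_subset,
      isPathConnected_pathComponentIn (hWP hx)⟩ h1).antisymm h1⟩
  · rintro ⟨x, hx, rfl⟩
    refine ⟨⟨pathComponentIn_subset, isPathConnected_pathComponentIn hx⟩, ?_⟩
    rintro S ⟨hSP, hS⟩ hsub
    exact hS.subset_pathComponentIn (hsub (mem_pathComponentIn_self hx)) hSP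

theorem mem_pathComponentIn_iff {P : Set (Fin n → ℝ)} {x y : Fin n → ℝ} :
    y ∈ pathComponentIn P x ↔ JoinedIn P x y := Iff.rfl

theorem pathComponentIn_eq_iff {P : Set (Fin n → ℝ)} {x y : Fin n → ℝ} (hx : x ∈ P) :
    pathComponentIn P x = pathComponentIn P y ↔ JoinedIn P y x :=
  ⟨fun h => by
    rw [← mem_pathComponentIn_iff, ← h]
    exact mem_pathComponentIn_self hx, fun h => pathComponentIn_congr h⟩

/-- Every path component of `D \ C`, for convex `C`, contains a vertex of `D`. -/
theorem exists_vertex_joinedIn (hD : convexHull ℝ (vertices D) = D) {C : Set (Fin n → ℝ)}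
    (hC : Convex ℝ C) {x : Fin n → ℝ} (hx : x ∈ D \ C) :
    ∃ v ∈ vertices D \ C, JoinedIn (D \ C) x v :=
  let ⟨v, hv, h⟩ := exists_vertex_segment_subset hD hC hx
  ⟨v, hv, joinedIn_of_segment_subset h⟩

theorem finite_pathComponents_diff (hfin : (vertices D).Finite)
    (hD : convexHull ℝ (vertices D) = D) {C : Set (Fin n → ℝ)} (hC : Convex ℝ C) :
    (pathComponents (D \ C)).Finite := by
  refine ((hfin.subset (sdiff_subset (t := C))).image (pathComponentIn (D \ C))).subset ?_
  rw [pathComponents_eq]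
  rintro _ ⟨x, hx, rfl⟩
  obtain ⟨v, hv, hxv⟩ := exists_vertex_joinedIn hD hC hx
  exact ⟨v, hv, pathComponentIn_congr hxv⟩

/-- For a polytope `D` and a compact convex `Q ⊆ D`, the union of `Q` with some path components of
`D \ Q` is convex. -/
theorem convex_union_iUnion {Q : Set (Fin n → ℝ)} (hDc : Convex ℝ D) (hQc : Convex ℝ Q)
    (hQ : IsClosed Q) (hQD : Q ⊆ D) (A : Set (Fin n → ℝ)) (hAD : A ⊆ D \ Q)
    (hA : ∀ x ∈ A, ∀ y, JoinedIn (D \ Q) x y → y ∈ A) : Convex ℝ (Q ∪ A) := by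
  rw [convex_iff_segment_subset]
  intro x hx y hy z hz
  by_cases hzQ : z ∈ Q
  · exact Or.inl hzQ
  have hsub : Q ∪ A ⊆ D := union_subset hQD (hAD.trans sdiff_subset)
  have hzD : z ∈ D := hDc.segment_subset (hsub hx) (hsub hy) hz
  obtain ⟨l, c, hl, hlz⟩ := geometric_hahn_banach_closed_point hQc hQ hzQ
  -- An end in the half-space around `z` lies in `A` and sees `z` without crossing `Q`; one end must
  -- be there.
  have main : ∀ w ∈ Q ∪ A, c < l w → z ∈ A := by
    intro w hw hlw
    have hwQ : w ∉ Q := fun h => (hl w h).not_gt hlw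
    refine hA w (hw.resolve_left hwQ) z (joinedIn_of_segment_subset fun u hu => ⟨?_, fun h => ?_⟩)
    · exact hDc.segment_subset (hsub hw) hzD hu
    · exact (hl u h).not_gt (segment_subset_lt hlw hlz hu)
  right
  by_contra hzA
  have h1 : l x ≤ c := not_lt.1 fun h => hzA (main x hx h)
  have h2 : l y ≤ c := not_lt.1 fun h => hzA (main y hy h)
  exact ((convex_halfSpace_le l.toLinearMap.isLinear c).segment_subset (x := x) (y := y) h1 h2
    hz).not_gt hlz

/-- For a polytope `D` and a polytope `Q = conv S ⊆ D`, the union of `Q` with some path components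
of `D \ Q` is the convex hull of `S` and the vertices of `D` in these components. -/
theorem union_eq_convexHull {S : Set (Fin n → ℝ)} (hfin : (vertices D).Finite)
    (hD : convexHull ℝ (vertices D) = D) (hS : S.Finite) (hSD : convexHull ℝ S ⊆ D)
    {A : Set (Fin n → ℝ)} (hAD : A ⊆ D \ convexHull ℝ S)
    (hA : ∀ x ∈ A, ∀ y, JoinedIn (D \ convexHull ℝ S) x y → y ∈ A) :
    convexHull ℝ S ∪ A = convexHull ℝ (S ∪ (vertices D ∩ A)) := by
  have hDc : Convex ℝ D := hD ▸ convex_convexHull ℝ _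
  have hfin' : (S ∪ (vertices D ∩ A)).Finite := hS.union (hfin.subset inter_subset_left)
  apply Subset.antisymm
  · refine union_subset (convexHull_mono subset_union_left) fun x hx => ?_
    by_contra hxR
    obtain ⟨l, c, hl, hlx⟩ := geometric_hahn_banach_closed_point (convex_convexHull ℝ _)
      (hfin'.isClosed_convexHull ℝ) hxR
    obtain ⟨v, hv, hlv⟩ := exists_vertex_lt hD (hAD hx).1 hlx
    have hvA : v ∈ A := by
      refine hA x hx v (joinedIn_of_segment_subset fun u hu => ⟨?_, fun h => ?_⟩)
      · exact hDc.segment_subset (hAD hx).1 hv.1 hu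
      · exact (hl u (convexHull_mono subset_union_left h)).not_gt (segment_subset_lt hlx hlv hu)
    exact (hl v (subset_convexHull _ _ (Or.inr ⟨hv, hvA⟩))).not_gt hlv
  · exact convexHull_min (union_subset_union (subset_convexHull _ _) inter_subset_right)
      (convex_union_iUnion hDc (convex_convexHull ℝ _) (hS.isClosed_convexHull ℝ) hSD A hAD hA)

end PolyCut

/-! ### The main theorem -/

open Set PolyCut in
theorem proposition2p7 {n : ℕ} (D U : Set (Fin n → ℝ))
    (hD : PolyCut.IsPolyhedron D) (hDb : Bornology.IsBounded D) (hU : Convex ℝ U)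
    (p : Set (Fin n → ℝ) → (Fin n → ℝ))
    (hp : ∀ e ∈ PolyCut.cutEdges D U, p e ∈ e ∩ U) :
    (PolyCut.pathComponents (D \ U)).Finite ∧
    ∀ (q : ℕ) (W : Fin q → Set (Fin n → ℝ)), PolyCut.EnumeratesComponents (D \ U) W →
      ∃ V : Fin q → Set (Fin n → ℝ),
        PolyCut.EnumeratesComponents (D \ PolyCut.cutHull D U p) V ∧
        (∀ i, W i ⊆ V i) ∧
        (∀ I : Set (Fin q),
          PolyCut.cutHull D U p ∪ ⋃ i ∈ I, V i =
            convexHull ℝ (PolyCut.cutPoints D U p ∪ ⋃ i ∈ I, (PolyCut.vertices D ∩ V i))) ∧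
        (∀ i, W i = (PolyCut.cutHull D U p ∪ V i) \ U) ∧
        (∀ i, PolyCut.IsPolyhedron (PolyCut.cutHull D U p ∪ V i)) := by
  have hfin := hD.finite_vertices
  have hconv := hD.convexHull_vertices hDb
  have hQU := cutHull_subset hU hp
  have hQD := cutHull_subset_left hD.convex hp
  have hS : (cutPoints D U p).Finite := finite_cutPoints hfin hconv
  have hsub : D \ U ⊆ D \ cutHull D U p := sdiff_subset_sdiff_right hQU
  refine ⟨finite_pathComponents_diff hfin hconv hU, fun q W hW => ?_⟩
  rw [EnumeratesComponents, pathComponents_eq] at hW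
  obtain ⟨hinj, hrange⟩ := hW
  have hex : ∀ i, ∃ x ∈ D \ U, pathComponentIn (D \ U) x = W i := fun i =>
    hrange.subset (mem_range_self i)
  choose x hx hxW using hex
  set V : Fin q → Set (Fin n → ℝ) := fun i => pathComponentIn (D \ cutHull D U p) (x i) with hV
  have hVinj : Function.Injective V := by
    intro i j hij
    refine hinj ?_
    rw [← hxW, ← hxW, pathComponentIn_eq_iff (hx i)]
    exact joinedIn_diff_of_joinedIn_diff_cutHull hfin hconv hU hp (hS.isClosed_convexHull ℝ) hQU
      (hx j) (hx i) ((pathComponentIn_eq_iff (hsub (hx i))).1 hij)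
  have hWV : ∀ i, W i ⊆ V i := fun i => hxW i ▸ pathComponentIn_mono hsub
  have hVrange : range V = pathComponents (D \ cutHull D U p) := by
    rw [pathComponents_eq]
    apply Subset.antisymm
    · rintro _ ⟨i, rfl⟩
      exact ⟨x i, hsub (hx i), rfl⟩
    · rintro _ ⟨y, hy, rfl⟩
      obtain ⟨v, hv, hyv⟩ := exists_vertex_joinedIn hconv (convex_convexHull ℝ _) hy
      -- Vertices of `D` in `U` belong to `Q`.
      have hvU : v ∈ D \ U :=
        ⟨hv.1.1, fun h => hv.2 (subset_convexHull _ _ (Or.inl ⟨h, hv.1⟩))⟩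
      obtain ⟨i, hi⟩ := hrange.symm.subset ⟨v, hvU, rfl⟩
      have hvW : v ∈ W i := hi ▸ mem_pathComponentIn_self hvU
      exact ⟨i, (pathComponentIn_congr (hWV i hvW)).symm.trans (pathComponentIn_congr hyv)⟩
  have hVD : ∀ i, V i ⊆ D \ cutHull D U p := fun i => pathComponentIn_subset
  have hunion : ∀ I : Set (Fin q), cutHull D U p ∪ ⋃ i ∈ I, V i =
      convexHull ℝ (cutPoints D U p ∪ ⋃ i ∈ I, (vertices D ∩ V i)) := by
    intro I
    rw [← inter_iUnion₂]
    refine union_eq_convexHull hfin hconv hS hQD (iUnion₂_subset fun i _ => hVD i) ?_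
    intro y hy z hyz
    simp only [mem_iUnion] at hy ⊢
    obtain ⟨i, hi, hy⟩ := hy
    exact ⟨i, hi, JoinedIn.trans hy hyz⟩
  refine ⟨V, ⟨hVinj, hVrange⟩, hWV, hunion, fun i => ?_, fun i => ?_⟩
  · apply Subset.antisymm
    · intro y hy
      exact ⟨Or.inr (hWV i hy), (pathComponentIn_subset (hxW i ▸ hy : y ∈ pathComponentIn _ _)).2⟩
    · rintro y ⟨hy, hyU⟩
      have hyV : y ∈ V i := hy.resolve_left fun h => hyU (hQU h)
      obtain ⟨j, hj⟩ := hrange.symm.subset ⟨y, ⟨(hVD i hyV).1, hyU⟩, rfl⟩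
      have hyW : y ∈ W j := hj ▸ mem_pathComponentIn_self ⟨(hVD i hyV).1, hyU⟩
      have hji : j = i := hVinj
        ((pathComponentIn_congr (hWV j hyW)).symm.trans (pathComponentIn_congr hyV))
      exact hji ▸ hyW
  · have h := hunion {i}
    simp only [mem_singleton_iff, iUnion_iUnion_eq_left] at h
    rw [h]
    exact isPolyhedron_convexHull (hS.union (hfin.subset inter_subset_left))
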